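/- Let $U_1,\dots,U_r$ be known unitaries on $\mathbb{C}^{d_\Lambda}$ and, for a probability vector $\theta=(\theta_1,\dots,\theta_r)$ in the simplex $\Theta=\{\theta\in\mathbb{R}^r:\theta_a\ge 0,\ \sum_a\theta_a=1\}$, let $\Lambda_\theta(\rho)=\sum_{a=1}^r\theta_a U_a\rho U_a^\dagger$ be the mixed unitary channel of rank $r$. An independent one-measurement-per-state (IOMS) protocol with probe dimension $d=d_\Lambda d_A$ and at most $k$ concatenations consists of finitely many rounds $i=1,\dots,M$, fixed in advance. Round $i$ prepares a density operator on $\mathbb{C}^{d_\Lambda}\otimes\mathbb{C}^{d_A}$, applies $V_{k_i}(\Lambda_\theta\otimes\mathrm{id})\cdots V_1(\Lambda_\theta\otimes\mathrm{id})$ to it, where $k_i\le k$ and $V_1,\dots,V_{k_i}$ are fixed unitaries on the probe (acting by conjugation), measures a fixed POVM with finitely many outcomes, and discards the state. The outcomes $X_1,\dots,X_M$ of the rounds are independent; the rounds may be identical, in which case the outcomes are i.i.d. The number of channel uses is $N=\sum_{i=1}^M k_i$. An estimator is any (possibly biased) function $\theta_N=\theta_N(X_1,\dots,X_M)\in\mathbb{R}^r$.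 **Theorem.** There is a universal constant $c>0$ such that for all integers $r\ge 2$ and $k\ge 1$ there is $\varepsilon_0=\varepsilon_0(r,k)>0$ with the following property. For all $d_\Lambda,d_A\ge 1$ with $d=d_\Lambda d_A$, all unitaries $U_1,\dots,U_r$ on $\mathbb{C}^{d_\Lambda}$, every IOMS protocol with probe dimension $d$ and at most $k$ concatenations, every estimator $\theta_N$, and every $0<\varepsilon\le\varepsilon_0$: if $$\sup_{\theta\in\Theta}\mathbb{E}_\theta\bigl[\|\theta_N-\theta\|_2^2\bigr]\le\varepsilon^2,$$ then $$N\ \ge\ c\,\frac{r}{k\,d\,\varepsilon^2}.$$ -/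

import Mathlib

open scoped Kronecker ComplexOrder

namespace IOMS

/-- Square matrices on the probe space: the channel input (dimension `dc`) tensored with the
ancilla (dimension `da`); the probe has total dimension `d = dc * da`. -/
abbrev ProbeMatrix (dc da : ℕ) : Type :=
  Matrix (Fin dc × Fin da) (Fin dc × Fin da) ℂ

/-- Density operators on the probe space. -/
def IsDensityOperator {dc da : ℕ} (ρ : ProbeMatrix dc da) : Prop :=
  ρ.PosSemidef ∧ ρ.trace = 1

/-- Positive operator-valued measures with `s` outcomes on the probe space. -/
def IsPOVM {dc da s : ℕ} (E : Fin s → ProbeMatrix dc da) : Prop :=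
  (∀ x, (E x).PosSemidef) ∧ ∑ x, E x = 1

/-- The mixed unitary channel `∑ a, θ a • U a (·) (U a)ᴴ`, acting on the first tensor factor of
the probe (and as the identity on the ancilla). -/
noncomputable def mixedUnitary {r dc : ℕ} (da : ℕ)
    (U : Fin r → Matrix.unitaryGroup (Fin dc) ℂ) (θ : Fin r → ℝ)
    (σ : ProbeMatrix dc da) : ProbeMatrix dc da :=
  ∑ a, (θ a : ℂ) •
    (((U a : Matrix (Fin dc) (Fin dc) ℂ) ⊗ₖ (1 : Matrix (Fin da) (Fin da) ℂ)) * σ *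
      ((U a : Matrix (Fin dc) (Fin dc) ℂ) ⊗ₖ (1 : Matrix (Fin da) (Fin da) ℂ)).conjTranspose)

/-- One round: prepare `state`; then, for each `V` in the list `unitaries`, in order, use the
unknown channel once and apply the known unitary `V` to the whole probe; finally measure
`povm` and discard the state. (A known unitary before the first channel use is
part of the state preparation.) -/
structure Round (dc da : ℕ) where
  state : ProbeMatrix dc da
  isDensityOperator : IsDensityOperator state
  unitaries : List (Matrix.unitaryGroup (Fin dc × Fin da) ℂ)
  outcomes : ℕ
  povm : Fin outcomes → ProbeMatrix dc da
  isPOVM : IsPOVM povm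

namespace Round

/-- The number of uses of the unknown channel in the round. -/
def uses {dc da : ℕ} (R : Round dc da) : ℕ := R.unitaries.length

/-- The state of the probe just before the measurement. -/
noncomputable def finalState {r dc da : ℕ} (R : Round dc da)
    (U : Fin r → Matrix.unitaryGroup (Fin dc) ℂ) (θ : Fin r → ℝ) : ProbeMatrix dc da :=
  R.unitaries.foldl
    (fun (σ : ProbeMatrix dc da) (V : Matrix.unitaryGroup (Fin dc × Fin da) ℂ) =>
      (V : ProbeMatrix dc da) * mixedUnitary da U θ σ * (V : ProbeMatrix dc da).conjTranspose) R.state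

/-- The Born probability of outcome `x`. -/
noncomputable def prob {r dc da : ℕ} (R : Round dc da)
    (U : Fin r → Matrix.unitaryGroup (Fin dc) ℂ) (θ : Fin r → ℝ) (x : Fin R.outcomes) : ℝ :=
  (R.povm x * R.finalState U θ).trace.re

end Round

/-- An independent one-measurement-per-state protocol: finitely many rounds, fixed in advance,
on probes of the same dimension. The rounds may, but need not, be identical. -/
structure Protocol (dc da : ℕ) where
  numRounds : ℕ
  round : Fin numRounds → Round dc da

namespace Protocol

/-- The record of all measurement outcomes. -/
abbrev Record {dc da : ℕ} (P : Protocol dc da) : Type :=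
  ∀ i, Fin (P.round i).outcomes

/-- The number of channel uses (samples) in the whole protocol. -/
def channelUses {dc da : ℕ} (P : Protocol dc da) : ℕ := ∑ i, (P.round i).uses

/-- The probability of a record: the outcomes of different rounds are independent. -/
noncomputable def prob {r dc da : ℕ} (P : Protocol dc da)
    (U : Fin r → Matrix.unitaryGroup (Fin dc) ℂ) (θ : Fin r → ℝ) (x : P.Record) : ℝ :=
  ∏ i, (P.round i).prob U θ (x i)

/-- The mean-square error, at parameter `θ`, of an estimator that is a function of the record. -/
noncomputable def meanSquareError {r dc da : ℕ} (P : Protocol dc da)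
    (U : Fin r → Matrix.unitaryGroup (Fin dc) ℂ)
    (est : P.Record → EuclideanSpace ℝ (Fin r)) (θ : Fin r → ℝ) : ℝ :=
  ∑ x : P.Record, P.prob U θ x * ‖est x - WithLp.toLp 2 θ‖ ^ 2

end Protocol

end IOMS

namespace IOMS

/-! The proof is Assouad's method around the uniform distribution. Group `2 * m` letters, `m =
⌊r/2⌋`, into pairs and shift the two weights of each pair by `±s/r` in opposite directions. If
neighbouring sign patterns are hard to distinguish, some pattern has mean-square error of order `m
(s/r)²`; with `s² = 12 ε² r` this level exceeds `ε²`.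

Expanding the channel into Kraus words makes a round with `n` uses a mixture of distributions `q x
w`, independent of `θ`, with product weights (`Round.exists_prob_eq_sum_words`). Here `q x w ≤ t x =
tr E_x`, and the `t x` sum to `d`; this is where the dimension enters. Flipping pair `j` changes the
probability of `x` by at most `4 s G_j`, where `G_j` is the uniform average of `q x w` weighted by
the number of letters of `w` in pair `j`.

The gain comes from treating all flips together: `∑ G_j² ≤ max G_j * ∑ G_j`, with `G_j ≤ 2 n t x /
r` and, the pairs being disjoint, `∑ G_j ≤ n p₀ x`. Dividing by the uniform mixture `p₀ x` and
summing over `x` bounds the total squared Hellinger distance by `O(s² n² d / r)`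
(`sum_one_sub_affinity_le`). Over independent rounds this adds up to `O(s² k N d / r)`, which must
be at least of order `r`; hence the bound on `N`. -/

/-! ### Trace inequalities for positive semidefinite matrices. -/

theorem re_trace_conjTranspose_mul_self {m n : Type*} [Fintype m] [Fintype n]
    (A : Matrix m n ℂ) : (A.conjTranspose * A).trace.re = ∑ j, ∑ i, ‖A i j‖ ^ 2 := by
  simp only [Matrix.trace, Matrix.diag, Matrix.mul_apply, Matrix.conjTranspose_apply,
    Complex.re_sum]
  refine Finset.sum_congr rfl fun j _ => Finset.sum_congr rfl fun i _ => ?_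
  rw [← Complex.normSq_eq_norm_sq, Complex.star_def, ← Complex.normSq_eq_conj_mul_self]
  simp

theorem sum_norm_sq_mul_le {l m n : Type*} [Fintype l] [Fintype m] [Fintype n]
    (A : Matrix l m ℂ) (B : Matrix m n ℂ) :
    ∑ j, ∑ i, ‖(A * B) i j‖ ^ 2 ≤ (∑ j, ∑ i, ‖A i j‖ ^ 2) * ∑ j, ∑ i, ‖B i j‖ ^ 2 := by
  have h : ∀ i j, ‖(A * B) i j‖ ^ 2 ≤ (∑ x, ‖A i x‖ ^ 2) * ∑ x, ‖B x j‖ ^ 2 := by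
    intro i j
    refine le_trans ?_ (Finset.sum_mul_sq_le_sq_mul_sq Finset.univ (fun x => ‖A i x‖)
      fun x => ‖B x j‖)
    rw [Matrix.mul_apply]
    gcongr
    exact (norm_sum_le _ _).trans (by simp)
  calc ∑ j, ∑ i, ‖(A * B) i j‖ ^ 2
      ≤ ∑ j, ∑ i, (∑ x, ‖A i x‖ ^ 2) * ∑ x, ‖B x j‖ ^ 2 := by gcongr; exact h _ _
    _ = _ := by
      rw [Finset.sum_comm (f := fun j i => ‖A i j‖ ^ 2), Finset.sum_mul_sum, Finset.sum_comm]

open scoped MatrixOrder in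
theorem exists_eq_conjTranspose_mul_self {n : Type*} [Fintype n] [DecidableEq n]
    {A : Matrix n n ℂ} (hA : A.PosSemidef) : ∃ C : Matrix n n ℂ, A = C.conjTranspose * C := by
  refine ⟨CFC.sqrt A, ?_⟩
  have h : (CFC.sqrt A).conjTranspose = CFC.sqrt A := 
    (Matrix.nonneg_iff_posSemidef.mp (CFC.sqrt_nonneg A)).isHermitian
  rw [h, CFC.sqrt_mul_sqrt_self A hA.nonneg]

/-- The trace of a product of positive semidefinite matrices is nonnegative and at most the
product of the traces. -/
theorem re_trace_mul_mem_Icc {n : Type*} [Fintype n] [DecidableEq n] {A B : Matrix n n ℂ}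
    (hA : A.PosSemidef) (hB : B.PosSemidef) :
    0 ≤ (A * B).trace.re ∧ (A * B).trace.re ≤ A.trace.re * B.trace.re := by
  obtain ⟨C, rfl⟩ := exists_eq_conjTranspose_mul_self hA
  obtain ⟨D, rfl⟩ := exists_eq_conjTranspose_mul_self hB
  -- By cyclicity the trace is the squared Frobenius norm of `C * Dᴴ`, so submultiplicativity of
  -- that norm gives the upper bound.
  have h : (C.conjTranspose * C * (D.conjTranspose * D)).trace =
      ((C * D.conjTranspose).conjTranspose * (C * D.conjTranspose)).trace := by
    rw [Matrix.conjTranspose_mul, Matrix.conjTranspose_conjTranspose,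
      ← Matrix.mul_assoc, Matrix.trace_mul_comm]
    simp only [Matrix.mul_assoc]
  rw [h]
  simp only [re_trace_conjTranspose_mul_self]
  refine ⟨by positivity, (sum_norm_sq_mul_le _ _).trans_eq ?_⟩
  congr 1
  simp only [Matrix.conjTranspose_apply, norm_star]
  rw [Finset.sum_comm]

theorem isDensityOperator_conj {dc da : ℕ} {ρ : ProbeMatrix dc da} (hρ : IsDensityOperator ρ)
    {W : ProbeMatrix dc da} (hW : W.conjTranspose * W = 1) :
    IsDensityOperator (W * ρ * W.conjTranspose) := by
  refine ⟨hρ.1.mul_mul_conjTranspose_same W, ?_⟩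
  rw [Matrix.trace_mul_comm, ← Matrix.mul_assoc, hW, one_mul, hρ.2]

theorem conjTranspose_mul_self_of_unitary {n : Type*} [Fintype n] [DecidableEq n]
    (V : Matrix.unitaryGroup n ℂ) :
    (V : Matrix n n ℂ).conjTranspose * (V : Matrix n n ℂ) = 1 := by
  rw [← Matrix.star_eq_conjTranspose]
  exact Unitary.coe_star_mul_self V

/-! ### Rounds as mixtures over Kraus words. -/

/-- Expansion of the iterated channel over the words of Kraus labels. -/
theorem exists_foldl_eq_sum_words {r dc da : ℕ} (U : Fin r → Matrix.unitaryGroup (Fin dc) ℂ)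
    {ρ : ProbeMatrix dc da} (hρ : IsDensityOperator ρ) (n : ℕ) :
    ∀ L : List (Matrix.unitaryGroup (Fin dc × Fin da) ℂ), L.length = n →
      ∃ S : (Fin n → Fin r) → ProbeMatrix dc da, (∀ w, IsDensityOperator (S w)) ∧
        ∀ θ : Fin r → ℝ, L.foldl
          (fun (σ : ProbeMatrix dc da) (V : Matrix.unitaryGroup (Fin dc × Fin da) ℂ) =>
            (V : ProbeMatrix dc da) * mixedUnitary da U θ σ *
              (V : ProbeMatrix dc da).conjTranspose) ρ =
          ∑ w, ((∏ l, θ (w l) : ℝ) : ℂ) • S w := by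
  induction n with
  | zero =>
    intro L hL
    obtain rfl := List.length_eq_zero_iff.mp hL
    exact ⟨fun _ => ρ, fun _ => hρ, fun θ => by simp⟩
  | succ n ih =>
    intro L hL
    -- The fold applies the last unitary outermost, so the list is peeled from its end; letter `0`
    -- of a word is the latest channel use.
    obtain rfl | ⟨L, V, rfl⟩ := List.eq_nil_or_concat L
    · simp at hL
    obtain ⟨S, hS, hfold⟩ := ih L (by simpa using hL)
    let K : Fin r → ProbeMatrix dc da := fun a => (V : ProbeMatrix dc da) *
      ((U a : Matrix (Fin dc) (Fin dc) ℂ) ⊗ₖ (1 : Matrix (Fin da) (Fin da) ℂ))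
    have hK : ∀ a, (K a).conjTranspose * K a = 1 := by
      intro a
      simp only [K, Matrix.conjTranspose_mul]
      rw [Matrix.mul_assoc, ← Matrix.mul_assoc _ (V : ProbeMatrix dc da),
        conjTranspose_mul_self_of_unitary V, one_mul, Matrix.conjTranspose_kronecker,
        ← Matrix.mul_kronecker_mul, conjTranspose_mul_self_of_unitary (U a)]
      simp
    refine ⟨fun w => K (w 0) * S (fun l => w l.succ) * (K (w 0)).conjTranspose,
      fun w => isDensityOperator_conj (hS _) (hK _), fun θ => ?_⟩
    rw [List.concat_eq_append, List.foldl_append, hfold θ, List.foldl_cons, List.foldl_nil,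
      ← (Fin.consEquiv fun _ => Fin r).sum_comp, Fintype.sum_prod_type]
    simp only [mixedUnitary, Matrix.mul_sum, Matrix.sum_mul, Fin.consEquiv_apply,
      Fin.prod_univ_succ, Fin.cons_zero, Fin.cons_succ, Complex.ofReal_mul]
    refine Finset.sum_congr rfl fun a _ => ?_
    simp only [Finset.smul_sum, Matrix.mul_sum, Matrix.sum_mul]
    refine Finset.sum_congr rfl fun w _ => ?_
    simp only [K, Matrix.mul_smul, Matrix.smul_mul, smul_smul, Matrix.conjTranspose_mul,
      Matrix.mul_assoc]

/-- The outcome distribution of a round is a mixture, with product weights, of conditional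
distributions `q x w` that are dominated by a measure `t` of total mass the probe dimension. -/
theorem Round.exists_prob_eq_sum_words {r dc da : ℕ} (R : Round dc da)
    (U : Fin r → Matrix.unitaryGroup (Fin dc) ℂ) :
    ∃ (q : Fin R.outcomes → (Fin R.uses → Fin r) → ℝ) (t : Fin R.outcomes → ℝ),
      (∀ x w, 0 ≤ q x w) ∧ (∀ x w, q x w ≤ t x) ∧ (∀ w, ∑ x, q x w = 1) ∧
      ∑ x, t x = ((dc * da : ℕ) : ℝ) ∧
      ∀ θ x, R.prob U θ x = ∑ w, (∏ l, θ (w l)) * q x w := by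
  obtain ⟨S, hS, hfold⟩ := exists_foldl_eq_sum_words U R.isDensityOperator _ R.unitaries rfl
  refine ⟨fun x w => (R.povm x * S w).trace.re, fun x => (R.povm x).trace.re,
    fun x w => (re_trace_mul_mem_Icc (R.isPOVM.1 x) (hS w).1).1, fun x w => ?_, fun w => ?_, ?_,
    fun θ x => ?_⟩
  · refine (re_trace_mul_mem_Icc (R.isPOVM.1 x) (hS w).1).2.trans_eq ?_
    rw [(hS w).2]; simp
  · rw [← Complex.re_sum, ← Matrix.trace_sum, ← Matrix.sum_mul, R.isPOVM.2, one_mul, (hS w).2]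
    simp
  · rw [← Complex.re_sum, ← Matrix.trace_sum, R.isPOVM.2]
    simp
  · rw [Round.prob, Round.finalState, hfold θ, Matrix.mul_sum, Matrix.trace_sum, Complex.re_sum]
    refine Finset.sum_congr rfl fun w _ => ?_
    rw [Matrix.mul_smul, Matrix.trace_smul, smul_eq_mul, Complex.re_ofReal_mul]
    rfl

/-! ### Word mixtures near the uniform distribution and their Hellinger distances. -/

theorem abs_prod_sub_prod_le {ι : Type*} (S : Finset ι) {f g : ι → ℝ} {M : ℝ} (hM : 1 ≤ M)
    (hf : ∀ i, |f i| ≤ M) (hg : ∀ i, |g i| ≤ M) :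
    |∏ i ∈ S, f i - ∏ i ∈ S, g i| ≤ M ^ S.card * ∑ i ∈ S, |f i - g i| := by
  classical
  induction S using Finset.induction_on with
  | empty => simp
  | insert a S ha ih =>
    rw [Finset.prod_insert ha, Finset.prod_insert ha, Finset.sum_insert ha,
      Finset.card_insert_of_notMem ha]
    have hprod : |∏ i ∈ S, g i| ≤ M ^ S.card := by
      rw [Finset.abs_prod]
      exact (Finset.prod_le_prod (fun _ _ => abs_nonneg _) fun i _ => hg i).trans_eq (by simp)
    have hpow : M ^ S.card ≤ M ^ (S.card + 1) := pow_le_pow_right₀ hM (Nat.le_succ _)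
    calc |f a * ∏ i ∈ S, f i - g a * ∏ i ∈ S, g i|
        = |(f a - g a) * ∏ i ∈ S, g i + f a * (∏ i ∈ S, f i - ∏ i ∈ S, g i)| := by
          congr 1; ring
      _ ≤ |f a - g a| * |∏ i ∈ S, g i| + |f a| * |∏ i ∈ S, f i - ∏ i ∈ S, g i| := by
          rw [← abs_mul, ← abs_mul]; exact abs_add_le _ _
      _ ≤ |f a - g a| * M ^ (S.card + 1) + M * (M ^ S.card * ∑ i ∈ S, |f i - g i|) := by
          gcongr
          · exact hprod.trans hpow
          · exact hf a
      _ = _ := by ring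

section WordMixture

variable {r n : ℕ}

/-- The mixture of the numbers `q w` over words with independent letters of weights `θ`. -/
noncomputable def wordMixture (θ : Fin r → ℝ) (q : (Fin n → Fin r) → ℝ) : ℝ :=
  ∑ w, (∏ l, θ (w l)) * q w

/-- The uniform distribution on `r` letters, perturbed by a relative amount `s * a`. -/
noncomputable def perturbedUniform (s : ℝ) (a : Fin r → ℝ) (i : Fin r) : ℝ :=
  (r : ℝ)⁻¹ * (1 + s * a i)

/-- The mixture at the uniform distribution, weighted by the sum of the scores of the letters. -/
noncomputable def scoreMixture (c : Fin r → ℝ) (q : (Fin n → Fin r) → ℝ) : ℝ :=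
  wordMixture (fun _ => (r : ℝ)⁻¹) fun w => (∑ l, c (w l)) * q w

theorem prod_perturbedUniform (s : ℝ) (a : Fin r → ℝ) (w : Fin n → Fin r) :
    ∏ l, perturbedUniform s a (w l) = (∏ _l : Fin n, (r : ℝ)⁻¹) * ∏ l, (1 + s * a (w l)) :=
  Finset.prod_mul_distrib

theorem one_half_le_one_sub_pow {s : ℝ} (hs' : s ≤ 1) (hns : n * s ≤ 1 / 2) :
    1 / 2 ≤ (1 - s) ^ n := by
  have := one_add_mul_le_pow (a := -s) (by linarith) n
  rw [← sub_eq_add_neg] at this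
  linarith

theorem one_add_pow_le_two {s : ℝ} (hs : 0 ≤ s) (hs' : s ≤ 1) (hns : n * s ≤ 1 / 2) :
    (1 + s) ^ n ≤ 2 := by
  have h1 := one_half_le_one_sub_pow hs' hns
  have h2 : (1 + s) ^ n * (1 - s) ^ n ≤ 1 := by
    rw [← mul_pow]
    exact pow_le_one₀ (by nlinarith) (by nlinarith)
  have h3 : 0 ≤ (1 + s) ^ n := by positivity
  nlinarith

theorem wordMixture_nonneg {θ : Fin r → ℝ} (hθ : ∀ i, 0 ≤ θ i) {q : (Fin n → Fin r) → ℝ}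
    (hq : ∀ w, 0 ≤ q w) : 0 ≤ wordMixture θ q :=
  Finset.sum_nonneg fun w _ => mul_nonneg (Finset.prod_nonneg fun _ _ => hθ _) (hq w)

theorem perturbedUniform_nonneg {s : ℝ} (hs : 0 ≤ s) (hs' : s ≤ 1) {a : Fin r → ℝ}
    (ha : ∀ i, |a i| ≤ 1) (i : Fin r) : 0 ≤ perturbedUniform s a i := by
  have := abs_le.mp (ha i)
  exact mul_nonneg (by positivity) (by nlinarith)

theorem half_wordMixture_le {s : ℝ} (hs : 0 ≤ s) (hs' : s ≤ 1) (hns : n * s ≤ 1 / 2)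
    {a : Fin r → ℝ} (ha : ∀ i, |a i| ≤ 1) {q : (Fin n → Fin r) → ℝ} (hq : ∀ w, 0 ≤ q w) :
    1 / 2 * wordMixture (fun _ => (r : ℝ)⁻¹) q ≤ wordMixture (perturbedUniform s a) q := by
  rw [wordMixture, wordMixture, Finset.mul_sum]
  refine Finset.sum_le_sum fun w _ => ?_
  rw [prod_perturbedUniform, ← mul_assoc, mul_comm (1 / 2 : ℝ)]
  refine mul_le_mul_of_nonneg_right (mul_le_mul_of_nonneg_left ?_ (by positivity)) (hq w)
  calc (1 / 2 : ℝ) ≤ (1 - s) ^ n := one_half_le_one_sub_pow hs' hns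
    _ = ∏ _l : Fin n, (1 - s) := by simp
    _ ≤ _ := Finset.prod_le_prod (fun _ _ => by linarith) fun l _ => by
      have := abs_le.mp (ha (w l)); nlinarith

/-- Replacing the factors of a word's weight one at a time costs `s * (2 * c)` per letter, and the
remaining factors contribute at most `(1 + s)ⁿ ≤ 2`. -/
theorem abs_wordMixture_sub_le {s : ℝ} (hs : 0 ≤ s) (hs' : s ≤ 1) (hns : n * s ≤ 1 / 2)
    {a b c : Fin r → ℝ} (ha : ∀ i, |a i| ≤ 1) (hb : ∀ i, |b i| ≤ 1)
    (hab : ∀ i, |a i - b i| ≤ 2 * c i) {q : (Fin n → Fin r) → ℝ} (hq : ∀ w, 0 ≤ q w) :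
    |wordMixture (perturbedUniform s a) q - wordMixture (perturbedUniform s b) q| ≤
      4 * s * scoreMixture c q := by
  have hbound : ∀ {e : Fin r → ℝ}, (∀ i, |e i| ≤ 1) → ∀ i, |1 + s * e i| ≤ 1 + s := by
    intro e he i
    have := abs_le.mp (he i)
    rw [abs_le]; constructor <;> nlinarith
  rw [scoreMixture, wordMixture, wordMixture, wordMixture, ← Finset.sum_sub_distrib,
    Finset.mul_sum]
  refine (Finset.abs_sum_le_sum_abs _ _).trans (Finset.sum_le_sum fun w _ => ?_)
  rw [prod_perturbedUniform, prod_perturbedUniform, ← sub_mul, ← mul_sub, abs_mul, abs_mul,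
    abs_of_nonneg (hq w), abs_of_nonneg (by positivity : 0 ≤ ∏ _l : Fin n, (r : ℝ)⁻¹)]
  have h1 : |∏ l, (1 + s * a (w l)) - ∏ l, (1 + s * b (w l))| ≤
      2 * ∑ l, s * (2 * c (w l)) := by
    refine (abs_prod_sub_prod_le Finset.univ (by linarith : 1 ≤ 1 + s)
      (fun l => hbound ha (w l)) fun l => hbound hb (w l)).trans ?_
    refine mul_le_mul ?_ (Finset.sum_le_sum fun l _ => ?_) (by positivity) (by norm_num)
    · simpa using one_add_pow_le_two hs hs' hns
    · rw [add_sub_add_left_eq_sub, ← mul_sub, abs_mul, abs_of_nonneg hs]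
      exact mul_le_mul_of_nonneg_left (hab _) hs
  calc _ ≤ (∏ _l : Fin n, (r : ℝ)⁻¹) * (2 * ∑ l, s * (2 * c (w l))) * q w :=
        mul_le_mul_of_nonneg_right (mul_le_mul_of_nonneg_left h1 (by positivity)) (hq w)
    _ = _ := by
      rw [← Finset.mul_sum, ← Finset.mul_sum]; ring

theorem sum_prod_uniform_mul (hr : 0 < r) (c : Fin r → ℝ) (l : Fin n) :
    ∑ w : Fin n → Fin r, (∏ _l : Fin n, (r : ℝ)⁻¹) * c (w l) = (r : ℝ)⁻¹ * ∑ i, c i := by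
  -- A product of one-letter sums in which only position `l` carries `c`; the other positions sum to
  -- 1.
  have h := Fintype.prod_sum (R := ℝ) (κ := fun _ : Fin n => Fin r)
    fun l' i => (r : ℝ)⁻¹ * if l' = l then c i else 1
  have hr' : (r : ℝ) ≠ 0 := by positivity
  rw [Finset.prod_eq_single l (by intro b _ hb; simp [hb, hr']) (by simp)] at h
  simp only [if_true, Finset.prod_mul_distrib, Finset.prod_ite_eq', Finset.mem_univ] at h
  rw [Finset.mul_sum, h]

/-- Once `q` is replaced by `t`, only the expected score of `n` uniform letters remains. This
supplies the factor `1/r`. -/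
theorem scoreMixture_le (hr : 0 < r) {c : Fin r → ℝ} (hc : ∀ i, 0 ≤ c i)
    {q : (Fin n → Fin r) → ℝ} {t : ℝ} (hqt : ∀ w, q w ≤ t) :
    scoreMixture c q ≤ n * ((r : ℝ)⁻¹ * ∑ i, c i) * t := by
  calc scoreMixture c q
      ≤ ∑ w : Fin n → Fin r, (∏ _l : Fin n, (r : ℝ)⁻¹) * ((∑ l, c (w l)) * t) :=
        Finset.sum_le_sum fun w _ => mul_le_mul_of_nonneg_left
          (mul_le_mul_of_nonneg_left (hqt w) (Finset.sum_nonneg fun _ _ => hc _)) (by positivity)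
    _ = (∑ l, ∑ w : Fin n → Fin r, (∏ _l : Fin n, (r : ℝ)⁻¹) * c (w l)) * t := by
        rw [Finset.sum_comm, Finset.sum_mul]
        refine Finset.sum_congr rfl fun w _ => ?_
        rw [← Finset.mul_sum, mul_assoc]
    _ = _ := by
        rw [Finset.sum_congr rfl fun l _ => sum_prod_uniform_mul hr c l]
        simp

/-- Each letter carries total score at most 1 over all directions, so a word carries at most `n`,
however many directions there are. -/
theorem sum_scoreMixture_le {m : ℕ} {c : Fin m → Fin r → ℝ} (hc : ∀ i, ∑ j, c j i ≤ 1)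
    {q : (Fin n → Fin r) → ℝ} (hq : ∀ w, 0 ≤ q w) :
    ∑ j, scoreMixture (c j) q ≤ n * wordMixture (fun _ => (r : ℝ)⁻¹) q := by
  simp only [scoreMixture, wordMixture]
  rw [Finset.sum_comm, Finset.mul_sum]
  refine Finset.sum_le_sum fun w _ => ?_
  rw [← Finset.mul_sum, ← Finset.sum_mul, Finset.sum_comm]
  have : ∑ l, ∑ j, c j (w l) ≤ n :=
    (Finset.sum_le_sum fun l _ => hc (w l)).trans (by simp)
  calc _ ≤ (∏ _l : Fin n, (r : ℝ)⁻¹) * (n * q w) := by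
        gcongr
        exact hq w
    _ = _ := by ring

/-- `(√p - √q)² (√p + √q)² = (p - q)²`, and `(√p + √q)² ≥ p + q`. The product form avoids dividing
by a `z` that may vanish. -/
theorem sq_sqrt_sub_sqrt_le {p q : ℝ} (hp : 0 ≤ p) (hq : 0 ≤ q) {z y : ℝ} (hz : z ≤ p + q)
    (hy : |p - q| ≤ y) :
    (p + q - 2 * √(p * q)) * z ≤ y ^ 2 := by
  rw [Real.sqrt_mul hp]
  have h1 := Real.sq_sqrt hp
  have h2 := Real.sq_sqrt hq
  have h3 := Real.sqrt_nonneg p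
  have h4 := Real.sqrt_nonneg q
  have h5 : p + q - 2 * (√p * √q) = (√p - √q) ^ 2 := by rw [sub_sq, h1, h2]; ring
  have h6 : z ≤ (√p + √q) ^ 2 := by nlinarith [mul_nonneg h3 h4]
  rw [h5]
  calc (√p - √q) ^ 2 * z ≤ (√p - √q) ^ 2 * (√p + √q) ^ 2 := by gcongr
    _ = (p - q) ^ 2 := by rw [← mul_pow]; congr 1; linarith
    _ ≤ y ^ 2 := sq_le_sq.mpr (hy.trans (le_abs_self y))

/-- The total squared Hellinger distance, over a family of directions with disjoint supports,
for one round. -/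
theorem sum_one_sub_affinity_le {m : ℕ} {X : Type*} [Fintype X] (hr : 0 < r)
    {s : ℝ} (hs : 0 ≤ s) (hs' : s ≤ 1) (hns : n * s ≤ 1 / 2)
    {a : Fin r → ℝ} {b c : Fin m → Fin r → ℝ} (ha : ∀ i, |a i| ≤ 1) (hb : ∀ j i, |b j i| ≤ 1)
    (hab : ∀ j i, |a i - b j i| ≤ 2 * c j i) (hc : ∀ i, ∑ j, c j i ≤ 1)
    (hc2 : ∀ j, ∑ i, c j i ≤ 2)
    {q : X → (Fin n → Fin r) → ℝ} {t : X → ℝ} (hq : ∀ x w, 0 ≤ q x w) (hqt : ∀ x w, q x w ≤ t x)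
    (ha1 : ∑ x, wordMixture (perturbedUniform s a) (q x) = 1)
    (hb1 : ∀ j, ∑ x, wordMixture (perturbedUniform s (b j)) (q x) = 1) :
    ∑ j, (1 - ∑ x, √(wordMixture (perturbedUniform s a) (q x) *
      wordMixture (perturbedUniform s (b j)) (q x))) ≤ 16 * s ^ 2 * n ^ 2 * (∑ x, t x) / r := by
  have hc0 : ∀ j i, 0 ≤ c j i := fun j i => by linarith [abs_nonneg (a i - b j i), hab j i]
  set p := fun x => wordMixture (perturbedUniform s a) (q x) with hp
  set p' := fun j x => wordMixture (perturbedUniform s (b j)) (q x) with hp'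
  set p₀ := fun x => wordMixture (fun _ => (r : ℝ)⁻¹) (q x) with hp₀
  have hp_nn : ∀ x, 0 ≤ p x := fun x =>
    wordMixture_nonneg (perturbedUniform_nonneg hs hs' ha) (hq x)
  have hp'_nn : ∀ j x, 0 ≤ p' j x := fun j x =>
    wordMixture_nonneg (perturbedUniform_nonneg hs hs' (hb j)) (hq x)
  have hp₀_nn : ∀ x, 0 ≤ p₀ x := fun x => wordMixture_nonneg (fun _ => by positivity) (hq x)
  have hG_nn : ∀ j x, 0 ≤ scoreMixture (c j) (q x) := fun j x =>
    wordMixture_nonneg (fun _ => by positivity) fun w =>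
      mul_nonneg (Finset.sum_nonneg fun _ _ => hc0 _ _) (hq x w)
  have ht : ∀ x, 0 ≤ t x := fun x => (hq x fun _ => ⟨0, hr⟩).trans (hqt x _)
  have key : ∀ x, ∑ j, (p x + p' j x - 2 * √(p x * p' j x)) ≤ 32 * s ^ 2 * n ^ 2 / r * t x := by
    intro x
    have hj : ∀ j, (p x + p' j x - 2 * √(p x * p' j x)) * p₀ x ≤
        (4 * s * scoreMixture (c j) (q x)) ^ 2 := fun j =>
      sq_sqrt_sub_sqrt_le (hp_nn x) (hp'_nn j x)
        (by linarith [half_wordMixture_le hs hs' hns ha (hq x),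
          half_wordMixture_le hs hs' hns (hb j) (hq x)])
        (abs_wordMixture_sub_le hs hs' hns ha (hb j) (hab j) (hq x))
    have hG : ∀ j, scoreMixture (c j) (q x) ≤ n * ((r : ℝ)⁻¹ * 2) * t x := fun j =>
      (scoreMixture_le hr (hc0 j) (hqt x)).trans (by gcongr; exacts [ht x, hc2 j])
    have hsum := sum_scoreMixture_le hc (hq x)
    have htot : (∑ j, (p x + p' j x - 2 * √(p x * p' j x))) * p₀ x ≤
        32 * s ^ 2 * n ^ 2 / r * t x * p₀ x := by
      calc _ = ∑ j, (p x + p' j x - 2 * √(p x * p' j x)) * p₀ x := Finset.sum_mul _ _ _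
        _ ≤ ∑ j, 16 * s ^ 2 * (n * ((r : ℝ)⁻¹ * 2) * t x) * scoreMixture (c j) (q x) := by
          refine Finset.sum_le_sum fun j _ => (hj j).trans ?_
          calc (4 * s * scoreMixture (c j) (q x)) ^ 2
              = 16 * s ^ 2 * scoreMixture (c j) (q x) * scoreMixture (c j) (q x) := by ring
            _ ≤ _ := by gcongr; exacts [hG_nn j x, hG j]
        _ = 16 * s ^ 2 * (n * ((r : ℝ)⁻¹ * 2) * t x) * ∑ j, scoreMixture (c j) (q x) :=
          (Finset.mul_sum _ _ _).symm
        _ ≤ 16 * s ^ 2 * (n * ((r : ℝ)⁻¹ * 2) * t x) * (n * p₀ x) := by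
          have := ht x
          gcongr
        _ = _ := by ring
    -- If `p₀ x = 0`, every `q x w` vanishes, the uniform weights being nonzero; otherwise `p₀ x`
    -- cancels from `htot`.
    rcases (hp₀_nn x).eq_or_lt with h0 | hpos
    · have hzero : ∀ {e : Fin r → ℝ}, (∀ i, |e i| ≤ 1) →
          wordMixture (perturbedUniform s e) (q x) = 0 := by
        intro e he
        refine Finset.sum_eq_zero fun w _ => ?_
        have hw := (Finset.sum_eq_zero_iff_of_nonneg fun w _ =>
          mul_nonneg (Finset.prod_nonneg fun _ _ => by positivity) (hq x w)).mp h0.symm w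
            (Finset.mem_univ w)
        have hne : ∏ _l : Fin n, (r : ℝ)⁻¹ ≠ 0 := by
          have : (r : ℝ) ≠ 0 := by positivity
          exact Finset.prod_ne_zero_iff.mpr fun _ _ => inv_ne_zero this
        rw [(mul_eq_zero.mp hw).resolve_left hne, mul_zero]
      have h1 : p x = 0 := hzero ha
      have h2 : ∀ j, p' j x = 0 := fun j => hzero (hb j)
      have := ht x
      simp only [h1, h2, mul_zero, Real.sqrt_zero, add_zero, sub_zero, Finset.sum_const_zero]
      positivity
    · exact le_of_mul_le_mul_right htot hpos
  have hfinal : 2 * ∑ j, (1 - ∑ x, √(p x * p' j x)) ≤ 32 * s ^ 2 * n ^ 2 / r * ∑ x, t x := by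
    rw [Finset.mul_sum, Finset.mul_sum]
    refine le_trans (le_of_eq ?_) (Finset.sum_le_sum fun x _ => key x)
    rw [Finset.sum_comm]
    refine Finset.sum_congr rfl fun j _ => ?_
    rw [Finset.sum_sub_distrib, Finset.sum_add_distrib, ← Finset.mul_sum, ha1, hb1 j]
    ring
  have : 16 * s ^ 2 * n ^ 2 * (∑ x, t x) / r = (32 * s ^ 2 * n ^ 2 / r * ∑ x, t x) / 2 := by ring
  rw [this]
  linarith

end WordMixture

/-! ### Affinities and Assouad's lemma. -/

/-- Combined with `affinity_prod`, this makes `1 - affinity` subadditive over independent rounds. -/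
theorem one_sub_sum_one_sub_le_prod {ι : Type*} (S : Finset ι) {x : ι → ℝ} (h0 : ∀ i, 0 ≤ x i)
    (h1 : ∀ i, x i ≤ 1) : 1 - ∑ i ∈ S, (1 - x i) ≤ ∏ i ∈ S, x i := by
  classical
  induction S using Finset.induction_on with
  | empty => simp
  | insert a S ha ih =>
    rw [Finset.prod_insert ha, Finset.sum_insert ha]
    have hle : ∏ i ∈ S, x i ≤ 1 := Finset.prod_le_one (fun i _ => h0 i) fun i _ => h1 i
    nlinarith [mul_nonneg (sub_nonneg.mpr (h1 a)) (sub_nonneg.mpr hle)]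

/-- The Bhattacharyya coefficient of two distributions on a finite set. -/
noncomputable def affinity {X : Type*} [Fintype X] (p q : X → ℝ) : ℝ := ∑ x, √(p x * q x)

theorem affinity_nonneg {X : Type*} [Fintype X] (p q : X → ℝ) : 0 ≤ affinity p q :=
  Finset.sum_nonneg fun _ _ => Real.sqrt_nonneg _

theorem affinity_le_one {X : Type*} [Fintype X] {p q : X → ℝ} (hp : ∀ x, 0 ≤ p x)
    (hq : ∀ x, 0 ≤ q x) (hp1 : ∑ x, p x = 1) (hq1 : ∑ x, q x = 1) : affinity p q ≤ 1 := by
  have h := Real.sum_sqrt_mul_sqrt_le Finset.univ hp hq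
  simpa only [affinity, hp1, hq1, Real.sqrt_one, mul_one, ← Real.sqrt_mul (hp _)] using h

theorem affinity_prod {ι : Type*} [Fintype ι] [DecidableEq ι] {X : ι → Type*}
    [∀ i, Fintype (X i)] {p q : ∀ i, X i → ℝ} (hp : ∀ i x, 0 ≤ p i x) (hq : ∀ i x, 0 ≤ q i x) :
    affinity (fun x : ∀ i, X i => ∏ i, p i (x i)) (fun x => ∏ i, q i (x i)) =
      ∏ i, affinity (p i) (q i) := by
  simp only [affinity, Fintype.prod_sum, ← Finset.prod_mul_distrib]
  exact Finset.sum_congr rfl fun x _ =>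
    Real.sqrt_prod _ fun i _ => mul_nonneg (hp i _) (hq i _)

/-- Two hypotheses at distance `2 * δ` cannot both be estimated well. -/
theorem two_point_bound {X : Type*} [Fintype X] {p q : X → ℝ} (hp : ∀ x, 0 ≤ p x)
    (hq : ∀ x, 0 ≤ q x) (hp1 : ∑ x, p x = 1) (hq1 : ∑ x, q x = 1) (f : X → ℝ) (δ : ℝ) :
    δ ^ 2 * (4 * affinity p q - 2) ≤
      ∑ x, p x * (f x - δ) ^ 2 + ∑ x, q x * (f x + δ) ^ 2 := by
  have h : δ ^ 2 * (4 * affinity p q - 2) =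
      ∑ x, δ ^ 2 * (4 * √(p x * q x) - p x - q x) := by
    rw [← Finset.mul_sum, Finset.sum_sub_distrib, Finset.sum_sub_distrib, hp1, hq1, affinity,
      Finset.mul_sum]
    ring
  rw [h, ← Finset.sum_add_distrib]
  refine Finset.sum_le_sum fun x _ => ?_
  obtain ⟨a, ha⟩ : ∃ a, a = √(p x) := ⟨_, rfl⟩
  obtain ⟨b, hb⟩ : ∃ b, b = √(q x) := ⟨_, rfl⟩
  have hpa : p x = a ^ 2 := by rw [ha, Real.sq_sqrt (hp x)]
  have hqb : q x = b ^ 2 := by rw [hb, Real.sq_sqrt (hq x)]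
  rw [Real.sqrt_mul (hp x), ← ha, ← hb, hpa, hqb]
  -- The inequality holds outcome by outcome, with a sum of squares as certificate.
  have : a ^ 2 * (f x - δ) ^ 2 + b ^ 2 * (f x + δ) ^ 2 -
      δ ^ 2 * (4 * (a * b) - a ^ 2 - b ^ 2) =
      ((a + b) * f x - 2 * δ * (a - b)) ^ 2 / 2 + ((a - b) * f x) ^ 2 / 2 := by ring
  have h2 : 0 ≤ ((a + b) * f x - 2 * δ * (a - b)) ^ 2 / 2 + ((a - b) * f x) ^ 2 / 2 := by
    positivity
  linarith

/-- Reversal of the `j`-th sign. -/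
def flip {m : ℕ} (τ : Fin m → Bool) (j : Fin m) : Fin m → Bool := Function.update τ j (!τ j)

theorem flip_flip {m : ℕ} (τ : Fin m → Bool) (j : Fin m) : flip (flip τ j) j = τ := by
  simp [flip]

theorem sum_flip {m : ℕ} (j : Fin m) (g : (Fin m → Bool) → ℝ) : ∑ τ, g (flip τ j) = ∑ τ, g τ :=
  Equiv.sum_comp (Function.Involutive.toPerm (fun τ => flip τ j) fun τ => flip_flip τ j) g

/-- The sign of a Boolean. -/
def boolSign (b : Bool) : ℝ := if b then 1 else -1

theorem boolSign_not (b : Bool) : boolSign (!b) = -boolSign b := by cases b <;> simp [boolSign]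

theorem abs_boolSign (b : Bool) : |boolSign b| = 1 := by cases b <;> simp [boolSign]

/-- Assouad's lemma on the hypercube, in terms of affinities. -/
theorem exists_le_sum_sq_of_affinity {X : Type*} [Fintype X] {m : ℕ}
    {P : (Fin m → Bool) → X → ℝ} (hP : ∀ τ x, 0 ≤ P τ x) (hP1 : ∀ τ, ∑ x, P τ x = 1)
    {K : ℝ} (hK : ∀ τ, ∑ j, (1 - affinity (P τ) (P (flip τ j))) ≤ K)
    (f : X → Fin m → ℝ) (δ : ℝ) :
    ∃ τ, δ ^ 2 * (m - 2 * K) ≤ ∑ x, P τ x * ∑ j, (f x j - boolSign (τ j) * δ) ^ 2 := by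
  set ℓ : Fin m → (Fin m → Bool) → ℝ :=
    fun j τ => ∑ x, P τ x * (f x j - boolSign (τ j) * δ) ^ 2 with hℓ
  have hpair : ∀ j τ, δ ^ 2 * (4 * affinity (P τ) (P (flip τ j)) - 2) ≤
      ℓ j τ + ℓ j (flip τ j) := by
    intro j τ
    have h := two_point_bound (hP τ) (hP (flip τ j)) (hP1 τ) (hP1 (flip τ j))
      (fun x => f x j) (boolSign (τ j) * δ)
    have hs : boolSign (τ j) ^ 2 = 1 := by rw [← sq_abs, abs_boolSign, one_pow]
    have hflip : boolSign (flip τ j j) = -boolSign (τ j) := by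
      rw [← boolSign_not]; simp [flip]
    rw [mul_pow, hs, one_mul] at h
    simpa only [hℓ, hflip, neg_mul, sub_neg_eq_add] using h
  have htot : ∑ τ : Fin m → Bool, δ ^ 2 * (m - 2 * K) ≤ ∑ τ, ∑ j, ℓ j τ := by
    have h1 : ∀ τ : Fin m → Bool, 2 * (δ ^ 2 * (m - 2 * K)) ≤
        ∑ j, (ℓ j τ + ℓ j (flip τ j)) := by
      intro τ
      refine le_trans ?_ (Finset.sum_le_sum fun j _ => hpair j τ)
      have h2 : ∑ j, δ ^ 2 * (4 * affinity (P τ) (P (flip τ j)) - 2) =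
          δ ^ 2 * (2 * m - 4 * ∑ j, (1 - affinity (P τ) (P (flip τ j)))) := by
        rw [← Finset.mul_sum, Finset.sum_sub_distrib, Finset.sum_sub_distrib, ← Finset.mul_sum]
        simp only [Finset.sum_const, Finset.card_univ, Fintype.card_fin, nsmul_eq_mul, mul_one]
        ring
      rw [h2]
      nlinarith [mul_le_mul_of_nonneg_left (hK τ) (sq_nonneg δ)]
    have h3 := Finset.sum_le_sum fun τ (_ : τ ∈ Finset.univ) => h1 τ
    simp only [Finset.sum_add_distrib] at h3
    -- Flipping sign `j` permutes the cube, so both halves of each pair have the same sum over `τ`,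
    -- cancelling the factor 2.
    rw [Finset.sum_comm (f := fun τ j => ℓ j (flip τ j))] at h3
    simp only [sum_flip] at h3
    rw [Finset.sum_comm (f := fun j τ => ℓ j τ), ← Finset.mul_sum] at h3
    linarith
  obtain ⟨τ, -, hτ⟩ := Finset.exists_le_of_sum_le Finset.univ_nonempty htot
  refine ⟨τ, hτ.trans_eq ?_⟩
  simp only [hℓ, Finset.mul_sum]
  exact Finset.sum_comm

/-! ### The hypercube of parameters built from disjoint pairs of letters. -/

section Hypercube

variable {m r : ℕ}

/-- The perturbation direction of a sign vector: opposite signs on the two letters of each pair,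
and zero off the pairs. -/
noncomputable def hypercubeDirection (e : Fin m × Bool ↪ Fin r) (τ : Fin m → Bool) : Fin r → ℝ :=
  Function.extend e (fun z => boolSign z.2 * boolSign (τ z.1)) 0

/-- The indicator of the `j`-th pair of letters. -/
def pairIndicator (e : Fin m × Bool ↪ Fin r) (j : Fin m) (i : Fin r) : ℝ :=
  ∑ b, if e (j, b) = i then 1 else 0

theorem hypercubeDirection_apply (e : Fin m × Bool ↪ Fin r) (τ : Fin m → Bool)
    (z : Fin m × Bool) : hypercubeDirection e τ (e z) = boolSign z.2 * boolSign (τ z.1) :=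
  e.injective.extend_apply _ _ _

theorem abs_hypercubeDirection_le (e : Fin m × Bool ↪ Fin r) (τ : Fin m → Bool) (i : Fin r) :
    |hypercubeDirection e τ i| ≤ 1 := by
  by_cases h : ∃ z, e z = i
  · obtain ⟨z, rfl⟩ := h
    rw [hypercubeDirection_apply, abs_mul, abs_boolSign, abs_boolSign, one_mul]
  · rw [hypercubeDirection, Function.extend_apply' _ _ _ h]
    simp

theorem sum_hypercubeDirection (e : Fin m × Bool ↪ Fin r) (τ : Fin m → Bool) :
    ∑ i, hypercubeDirection e τ i = 0 := by
  rw [← Finset.sum_subset (Finset.subset_univ (Finset.univ.map e))]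
  · rw [Finset.sum_map, Fintype.sum_prod_type]
    simp [hypercubeDirection_apply, boolSign]
  · intro i _ hi
    rw [hypercubeDirection, Function.extend_apply' _ _ _ (by simpa using hi)]
    rfl

theorem pairIndicator_nonneg (e : Fin m × Bool ↪ Fin r) (j : Fin m) (i : Fin r) :
    0 ≤ pairIndicator e j i :=
  Finset.sum_nonneg fun _ _ => by split_ifs <;> norm_num

theorem sum_letters_pairIndicator (e : Fin m × Bool ↪ Fin r) (j : Fin m) :
    ∑ i, pairIndicator e j i = 2 := by
  simp only [pairIndicator]
  rw [Finset.sum_comm]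
  simp

theorem sum_pairIndicator_le (e : Fin m × Bool ↪ Fin r) (i : Fin r) :
    ∑ j, pairIndicator e j i ≤ 1 := by
  simp only [pairIndicator]
  rw [← Fintype.sum_prod_type fun z : Fin m × Bool => if e z = i then (1 : ℝ) else 0]
  rw [Finset.sum_boole]
  have h : (Finset.univ.filter fun z => e z = i).card ≤ 1 :=
    Finset.card_le_one.mpr fun z hz z' hz' =>
      e.injective ((Finset.mem_filter.mp hz).2.trans (Finset.mem_filter.mp hz').2.symm)
  exact_mod_cast h

theorem abs_hypercubeDirection_sub_flip_le (e : Fin m × Bool ↪ Fin r) (τ : Fin m → Bool)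
    (j : Fin m) (i : Fin r) :
    |hypercubeDirection e τ i - hypercubeDirection e (flip τ j) i| ≤
      2 * pairIndicator e j i := by
  by_cases h : ∃ z, e z = i
  · obtain ⟨⟨j', b⟩, rfl⟩ := h
    by_cases hj : j' = j
    · subst hj
      have h1 : 1 ≤ pairIndicator e j' (e (j', b)) := by
        refine le_trans (by simp) (Finset.single_le_sum (f := fun b' =>
          if e (j', b') = e (j', b) then (1 : ℝ) else 0) (fun _ _ => ?_) (Finset.mem_univ b))
        split_ifs <;> norm_num
      have h2 := abs_hypercubeDirection_le e τ (e (j', b))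
      have h3 := abs_hypercubeDirection_le e (flip τ j') (e (j', b))
      linarith [abs_sub (hypercubeDirection e τ (e (j', b)))
        (hypercubeDirection e (flip τ j') (e (j', b)))]
    · simp only [hypercubeDirection_apply, flip, Function.update_of_ne hj, sub_self, abs_zero]
      linarith [pairIndicator_nonneg e j (e (j', b))]
  · simp only [hypercubeDirection, Function.extend_apply' _ _ _ h, sub_self, abs_zero]
    linarith [pairIndicator_nonneg e j i]

theorem sum_perturbedUniform (hr : 0 < r) (s : ℝ) {a : Fin r → ℝ} (ha : ∑ i, a i = 0) :
    ∑ i, perturbedUniform s a i = 1 := by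
  have : (r : ℝ) ≠ 0 := by positivity
  simp only [perturbedUniform]
  rw [← Finset.mul_sum, Finset.sum_add_distrib, ← Finset.mul_sum, ha]
  simp [this]

end Hypercube

/-! ### From one round to the whole protocol. -/

theorem sum_wordMixture_eq_one {r n : ℕ} {X : Type*} [Fintype X] {θ : Fin r → ℝ}
    (hθ : ∑ i, θ i = 1) {q : X → (Fin n → Fin r) → ℝ} (hq : ∀ w, ∑ x, q x w = 1) :
    ∑ x, wordMixture θ (q x) = 1 := by
  simp only [wordMixture]
  rw [Finset.sum_comm]
  simp only [← Finset.mul_sum, hq, mul_one]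
  rw [← Fintype.prod_sum (fun (_ : Fin n) => θ)]
  simp [hθ]

/-- The outcome distributions of a round at the vertices of a hypercube of parameters: they are
probability distributions, and neighbouring vertices are hard to tell apart. -/
theorem Round.hypercube_bounds {r dc da m : ℕ} (hr : 0 < r) (R : Round dc da)
    (U : Fin r → Matrix.unitaryGroup (Fin dc) ℂ) (e : Fin m × Bool ↪ Fin r) {s : ℝ} (hs : 0 ≤ s)
    (hs' : s ≤ 1) (hns : R.uses * s ≤ 1 / 2) :
    (∀ τ x, 0 ≤ R.prob U (perturbedUniform s (hypercubeDirection e τ)) x) ∧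
    (∀ τ, ∑ x, R.prob U (perturbedUniform s (hypercubeDirection e τ)) x = 1) ∧
    ∀ τ, ∑ j, (1 - affinity (R.prob U (perturbedUniform s (hypercubeDirection e τ)))
        (R.prob U (perturbedUniform s (hypercubeDirection e (flip τ j))))) ≤
      16 * s ^ 2 * R.uses ^ 2 * ((dc * da : ℕ) : ℝ) / r := by
  obtain ⟨q, t, hq, hqt, hq1, ht, hprob⟩ := R.exists_prob_eq_sum_words U
  have hR : ∀ θ, R.prob U θ = fun x => wordMixture θ (q x) := fun θ => funext (hprob θ)
  have h1 : ∀ τ, ∑ x, wordMixture (perturbedUniform s (hypercubeDirection e τ)) (q x) = 1 :=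
    fun τ => sum_wordMixture_eq_one (sum_perturbedUniform hr s (sum_hypercubeDirection e τ)) hq1
  simp only [hR]
  refine ⟨fun τ x => wordMixture_nonneg
    (perturbedUniform_nonneg hs hs' (abs_hypercubeDirection_le e τ)) (hq x), h1, fun τ => ?_⟩
  rw [← ht]
  exact sum_one_sub_affinity_le hr hs hs' hns (abs_hypercubeDirection_le e τ)
    (fun j => abs_hypercubeDirection_le e (flip τ j))
    (abs_hypercubeDirection_sub_flip_le e τ) (sum_pairIndicator_le e)
    (fun j => (sum_letters_pairIndicator e j).le) hq hqt (h1 τ) fun j => h1 _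

theorem Protocol.exists_le_meanSquareError {r k dc da m : ℕ} (hr : 0 < r) (P : Protocol dc da)
    (U : Fin r → Matrix.unitaryGroup (Fin dc) ℂ) (est : P.Record → EuclideanSpace ℝ (Fin r))
    (hk : ∀ i, (P.round i).uses ≤ k) (e : Fin m × Bool ↪ Fin r) {s : ℝ} (hs : 0 ≤ s)
    (hs' : s ≤ 1) (hks : k * s ≤ 1 / 2) :
    ∃ θ ∈ stdSimplex ℝ (Fin r), (s / r) ^ 2 *
      (m - 2 * (16 * s ^ 2 * k * P.channelUses * ((dc * da : ℕ) : ℝ) / r)) ≤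
        P.meanSquareError U est θ := by
  have hround := fun i => (P.round i).hypercube_bounds hr U e hs hs'
    (le_trans (by gcongr; exact hk i) hks)
  set θ : (Fin m → Bool) → Fin r → ℝ := fun τ => perturbedUniform s (hypercubeDirection e τ)
  have hp0 : ∀ i τ x, 0 ≤ (P.round i).prob U (θ τ) x := fun i => (hround i).1
  have hp1 : ∀ i τ, ∑ x, (P.round i).prob U (θ τ) x = 1 := fun i => (hround i).2.1
  have hP0 : ∀ τ x, 0 ≤ P.prob U (θ τ) x := fun τ x => Finset.prod_nonneg fun i _ => hp0 i τ _
  have hP1 : ∀ τ, ∑ x, P.prob U (θ τ) x = 1 := by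
    intro τ
    simp only [Protocol.prob]
    rw [← Fintype.prod_sum]
    exact Finset.prod_eq_one fun i _ => hp1 i τ
  have hK : ∀ τ, ∑ j, (1 - affinity (P.prob U (θ τ)) (P.prob U (θ (flip τ j)))) ≤
      16 * s ^ 2 * k * P.channelUses * ((dc * da : ℕ) : ℝ) / r := by
    intro τ
    calc ∑ j, (1 - affinity (P.prob U (θ τ)) (P.prob U (θ (flip τ j))))
        ≤ ∑ j, ∑ i, (1 - affinity ((P.round i).prob U (θ τ))
            ((P.round i).prob U (θ (flip τ j)))) := by
          refine Finset.sum_le_sum fun j _ => ?_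
          have h1 : affinity (P.prob U (θ τ)) (P.prob U (θ (flip τ j))) = _ :=
            affinity_prod (fun i => hp0 i τ) fun i => hp0 i (flip τ j)
          have h2 := one_sub_sum_one_sub_le_prod Finset.univ
            (fun i => affinity_nonneg ((P.round i).prob U (θ τ))
              ((P.round i).prob U (θ (flip τ j))))
            fun i => affinity_le_one (hp0 i τ) (hp0 i (flip τ j)) (hp1 i τ) (hp1 i (flip τ j))
          rw [← h1] at h2
          linarith
      _ = ∑ i, ∑ j, (1 - affinity ((P.round i).prob U (θ τ))
            ((P.round i).prob U (θ (flip τ j)))) := Finset.sum_comm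
      _ ≤ ∑ i, 16 * s ^ 2 * (k * (P.round i).uses) * ((dc * da : ℕ) : ℝ) / r := by
          refine Finset.sum_le_sum fun i _ => ((hround i).2.2 τ).trans ?_
          -- Only one of the two factors `uses` is bounded by `k`; the other sums to the total
          -- number of channel uses.
          rw [sq ((P.round i).uses : ℝ)]
          gcongr
          exact hk i
      _ = _ := by
          rw [← Finset.sum_div, ← Finset.sum_mul, ← Finset.mul_sum, ← Finset.mul_sum,
            Protocol.channelUses]
          push_cast
          ring
  obtain ⟨τ, hτ⟩ := exists_le_sum_sq_of_affinity hP0 hP1 hK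
    -- One letter of each pair suffices: its weight is `1/r ± s/r`, with the sign of the pair.
    (fun x j => est x (e (j, true)) - (r : ℝ)⁻¹) (s / r)
  refine ⟨θ τ, ⟨perturbedUniform_nonneg hs hs' (abs_hypercubeDirection_le e τ),
    sum_perturbedUniform hr s (sum_hypercubeDirection e τ)⟩, hτ.trans ?_⟩
  refine Finset.sum_le_sum fun x _ => mul_le_mul_of_nonneg_left ?_ (hP0 τ x)
  rw [EuclideanSpace.norm_sq_eq]
  have hinj : Function.Injective fun j : Fin m => e (j, true) := fun j j' h => by
    simpa using e.injective h
  calc ∑ j, (est x (e (j, true)) - (r : ℝ)⁻¹ - boolSign (τ j) * (s / r)) ^ 2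
      = ∑ j, ‖(est x - WithLp.toLp 2 (θ τ)) (e (j, true))‖ ^ 2 := by
        refine Finset.sum_congr rfl fun j _ => ?_
        rw [Real.norm_eq_abs, sq_abs, PiLp.sub_apply]
        simp only [θ, perturbedUniform, hypercubeDirection_apply, boolSign, if_true]
        congr 1
        ring
    _ = ∑ i ∈ Finset.univ.map ⟨_, hinj⟩, ‖(est x - WithLp.toLp 2 (θ τ)) i‖ ^ 2 := by
        rw [Finset.sum_map]; rfl
    _ ≤ _ := Finset.sum_le_sum_of_subset_of_nonneg (Finset.subset_univ _)
        fun _ _ _ => by positivity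

end IOMS

/-! ### Choice of the constants. -/

theorem mainTheorem1 :
    ∃ c : ℝ, 0 < c ∧ ∀ r k : ℕ, 2 ≤ r → 1 ≤ k →
      ∃ ε₀ : ℝ, 0 < ε₀ ∧
        ∀ (dc da : ℕ), 1 ≤ dc → 1 ≤ da →
        ∀ (U : Fin r → Matrix.unitaryGroup (Fin dc) ℂ)
          (P : IOMS.Protocol dc da) (est : P.Record → EuclideanSpace ℝ (Fin r)) (ε : ℝ),
          (∀ i, (P.round i).uses ≤ k) →
          0 < ε → ε ≤ ε₀ →
          (∀ θ ∈ stdSimplex ℝ (Fin r), P.meanSquareError U est θ ≤ ε ^ 2) →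
          c * ((r : ℝ) / ((k : ℝ) * ((dc * da : ℕ) : ℝ) * ε ^ 2)) ≤ (P.channelUses : ℝ) := by
  -- The 7 gives `(k * s)² ≤ 12/49 ≤ 1/4`. The final inequality would even allow `1/1536` in place
  -- of `1/2304`.
  refine ⟨1 / 2304, by norm_num, fun r k hr hk => ⟨1 / (7 * k * r), by positivity, ?_⟩⟩
  intro dc da hdc hda U P est ε huses hε hε₀ hmse
  have hr' : (2 : ℝ) ≤ r := by exact_mod_cast hr
  have hk' : (1 : ℝ) ≤ k := by exact_mod_cast hk
  have hd : (0 : ℝ) < ((dc * da : ℕ) : ℝ) := by exact_mod_cast Nat.mul_pos hdc hda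
  obtain ⟨e⟩ : Nonempty (Fin (r / 2) × Bool ↪ Fin r) :=
    Function.Embedding.nonempty_of_card_le (by simp; omega)
  have hm : (r : ℝ) / 3 ≤ ((r / 2 : ℕ) : ℝ) := by
    have : r ≤ 3 * (r / 2) := by omega
    have : (r : ℝ) ≤ 3 * ((r / 2 : ℕ) : ℝ) := by exact_mod_cast this
    linarith
  -- As `m ≥ r/3`, this gives `m (s/r)² ≥ 4 ε²`, so the Hellinger term must absorb the excess over
  -- `ε²`.
  obtain ⟨s, hs, hs2⟩ : ∃ s : ℝ, 0 ≤ s ∧ s ^ 2 = 12 * ε ^ 2 * r :=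
    ⟨√(12 * ε ^ 2 * r), Real.sqrt_nonneg _, Real.sq_sqrt (by positivity)⟩
  have hks : k * s ≤ 1 / 2 := by
    have h1 : ε * (7 * k * r) ≤ 1 := by
      rwa [le_div_iff₀ (by positivity)] at hε₀
    have h2 : (k * s) ^ 2 ≤ (1 / 2) ^ 2 := by
      calc (k * s) ^ 2 = 12 * (ε * k) ^ 2 * r := by rw [mul_pow, hs2]; ring
        _ ≤ 12 * (ε * k) ^ 2 * r ^ 2 := by gcongr; nlinarith
        _ = 12 / 49 * (ε * (7 * k * r)) ^ 2 := by ring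
        _ ≤ 12 / 49 * 1 ^ 2 := by gcongr
        _ ≤ _ := by norm_num
    exact abs_le_of_sq_le_sq' h2 (by norm_num) |>.2
  have hs' : s ≤ 1 := by nlinarith
  obtain ⟨θ, hθ, hlow⟩ := P.exists_le_meanSquareError (by omega) U est huses e hs hs' hks
  have hbound := hlow.trans (hmse θ hθ)
  rw [div_pow, hs2] at hbound
  set D : ℝ := ((dc * da : ℕ) : ℝ)
  set N : ℝ := (P.channelUses : ℝ)
  set m : ℝ := ((r / 2 : ℕ) : ℝ)
  have h1 : 12 * ε ^ 2 * r / r ^ 2 * (m - 2 * (16 * (12 * ε ^ 2 * r) * k * N * D / r)) =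
      ε ^ 2 * (12 / r * (m - 384 * (ε ^ 2 * k * N * D))) := by
    field_simp
    ring
  rw [h1] at hbound
  have h2 : 12 / r * (m - 384 * (ε ^ 2 * k * N * D)) ≤ 1 :=
    le_of_mul_le_mul_left (hbound.trans_eq (mul_one _).symm) (by positivity)
  rw [div_mul_eq_mul_div, div_le_one (by positivity)] at h2
  rw [← mul_div_assoc, div_le_iff₀ (by positivity)]
  nlinarith
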